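/- Let $\mathcal H$ be a complex Hilbert space, $I\subset\mathbb R$ an interval, $\mathcal D\subset\mathcal H$ a dense linear subspace, and $H_1,\dots,H_n$ symmetric operators with common domain $\mathcal D$. Call a tuple $f=(f_1,\dots,f_n)$ of functions $f_i:I\to\mathbb R$ *admissible* if, for $H_f(t)=\sum_{i=1}^n f_i(t)H_i$ with domain $\mathcal D$, (i) $H_f(t)$ is self-adjoint for every $t\in I$; (ii) $f_i\in C^1(I)$ for every $i$; (iii) for every $i$ there is $K>0$ such that $\|H_i\Psi\|\le K(\|H_f(t)\Psi\|+\|\Psi\|)$ for all $\Psi\in\mathcal D$ and all $t\in I$. A unitary propagator for $H_f$ on $I$ is a family of unitary operators $U(t,s)$, $t,s\in I$, jointly strongly continuous in $(t,s)$, with $U(r,s)U(s,t)=U(r,t)$ and $U(t,t)=\mathbb 1$ for $r,s,t\in I$, such that for all $\Psi\in\mathcal D$ and $s\in I$ the curve $\Psi(t)=U(t,s)\Psi$ lies in $\mathcal D$ and satisfies $\frac{d}{dt}\Psi(t)=-iH_f(t)\Psi(t)$ for $t\in I$ (one-sided derivatives at end points of $I$). Let $f$ be admissible and let $U_1$ be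 a unitary propagator for $H_f$ on $I$. Then for every $\Psi\in\mathcal D$, every $T\in I$, every $s_0\in I$ and every $\varepsilon>0$ there exists $\delta>0$ such that for every admissible $g=(g_1,\dots,g_n)$ and every unitary propagator $U_2$ for $H_g$ on $I$: if $\|f_i-g_i\|_\infty=\sup_{t\in I}|f_i(t)-g_i(t)|<\delta$ for $i=1,\dots,n$, then $$\|U_1(T,s)\Psi-U_2(T,s)\Psi\|<\varepsilon$$ for every $s$ between $s_0$ and $T$ (inclusive); in particular this holds for $s=s_0$. -/

import Mathlib

open scoped ENNReal

noncomputable section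

/-- The action of `H(t) = ∑ i, f i t • A i` on the common domain `D` of the operators `A i`. -/
def hamiltonianMap {E : Type*} [NormedAddCommGroup E] [InnerProductSpace ℂ E] {n : ℕ}
    {D : Submodule ℂ E} (A : Fin n → D →ₗ[ℂ] E) (f : Fin n → ℝ → ℝ) (t : ℝ) : D →ₗ[ℂ] E :=
  ∑ i, ((f i t : ℝ) : ℂ) • A i

/-- The unbounded operator `H(t) = ∑ i, f i t • A i` with domain `D`. -/
def hamiltonian {E : Type*} [NormedAddCommGroup E] [InnerProductSpace ℂ E] {n : ℕ}
    (D : Submodule ℂ E) (A : Fin n → D →ₗ[ℂ] E) (f : Fin n → ℝ → ℝ) (t : ℝ) : E →ₗ.[ℂ] E where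
  domain := D
  toFun := hamiltonianMap A f t

/-- The hypotheses on the family `H(t) = ∑ i, f i t • A i`, `t ∈ I`: every `H(t)` is self-adjoint
(in the sense of unbounded operators, with domain exactly `D`), the coefficients are `C¹` on `I`,
and every `A i` is relatively bounded by `H(t)`, uniformly in `t ∈ I`. -/
structure AdmissibleCoefficients {E : Type*} [NormedAddCommGroup E] [InnerProductSpace ℂ E]
    [CompleteSpace E] {n : ℕ} (I : Set ℝ) (D : Submodule ℂ E) (A : Fin n → D →ₗ[ℂ] E)
    (f : Fin n → ℝ → ℝ) : Prop where
  selfAdjoint : ∀ t ∈ I, IsSelfAdjoint (hamiltonian D A f t)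
  contDiff : ∀ i, ContDiffOn ℝ 1 (f i) I
  bound : ∀ i, ∃ K : ℝ, 0 < K ∧ ∀ t ∈ I, ∀ Ψ : D,
    ‖A i Ψ‖ ≤ K * (‖hamiltonianMap A f t Ψ‖ + ‖(Ψ : E)‖)

/-- `U(t, s)`, `t, s ∈ I`, is a unitary propagator. (Values for times outside `I` are irrelevant.) -/
structure IsUnitaryPropagator {E : Type*} [NormedAddCommGroup E] [InnerProductSpace ℂ E]
    (I : Set ℝ) (U : ℝ → ℝ → (E ≃ₗᵢ[ℂ] E)) : Prop where
  comp : ∀ r ∈ I, ∀ s ∈ I, ∀ t ∈ I, ∀ Ψ : E, U r s (U s t Ψ) = U r t Ψ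
  refl : ∀ t ∈ I, ∀ Ψ : E, U t t Ψ = Ψ
  continuousOn : ∀ Ψ : E, ContinuousOn (fun p : ℝ × ℝ => U p.1 p.2 Ψ) (I ×ˢ I)

/-- `U` is a unitary propagator of the Schrödinger equation of `H(t) = ∑ i, f i t • A i` on `I`:
for `Ψ ∈ D` and `s ∈ I` the curve `Ψ(t) = U(t, s) Ψ` stays in `D`, is differentiable in norm
(one-sidedly at end points of `I`), and satisfies `Ψ'(t) = -i H(t) Ψ(t)`. -/
structure IsSchrodingerPropagator {E : Type*} [NormedAddCommGroup E] [InnerProductSpace ℂ E]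
    {n : ℕ} (I : Set ℝ) (D : Submodule ℂ E) (A : Fin n → D →ₗ[ℂ] E) (f : Fin n → ℝ → ℝ)
    (U : ℝ → ℝ → (E ≃ₗᵢ[ℂ] E)) : Prop extends IsUnitaryPropagator I U where
  hasDeriv : ∀ s ∈ I, ∀ Ψ ∈ D, ∀ t ∈ I, ∃ h : U t s Ψ ∈ D,
    HasDerivWithinAt (fun τ => U τ s Ψ)
      (-(Complex.I • hamiltonianMap A f t ⟨U t s Ψ, h⟩)) I t

/-- The supremum norm over `I`, as an extended nonnegative real. -/
def supNormOn (I : Set ℝ) (h : ℝ → ℝ) : ℝ≥0∞ := ⨆ t ∈ I, ‖h t‖ₑ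

end

/-! ### Resolvents of an unbounded self-adjoint operator. -/

section SelfAdjoint

variable {E : Type*} [NormedAddCommGroup E] [InnerProductSpace ℂ E] [CompleteSpace E]
  {D : Submodule ℂ E} {H : D →ₗ[ℂ] E}

/-! A Duhamel estimate along `U₁ t s Ψ` would need a bound on `A i (U₁ t s Ψ)` uniform in `t`, but
the propagator axioms give membership in `D` only pointwise. Instead both propagators are compared
with one vector `φ`, built from `f` alone and hence independent of `g` and `U₂`.

Divide the way from `s` to `T` into short steps and on each freeze `H_f` at the initial time. The
frozen flow preserves the graph norm of the frozen operator, and passing to the next grid point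
multiplies it by at most `1 + L * κ * |m|`, with `L` a Lipschitz constant of the coefficients and
`κ` from the relative bounds. These factors multiply up to at most an exponential, so all `A i` stay
bounded along the approximate orbit. That orbit nearly solves the Schrödinger equation for every `g`
close to `f`. By symmetry, the distance to a true solution grows no faster than the residual
(`IsSchrodingerPropagator.norm_sub_le`).

Stone's theorem is not needed: the frozen flow is replaced by the exponential of a bounded function
of `H` that commutes with a resolvent and nearly agrees with `H` at the initial vector
(`IsSelfAdjoint.exists_approx_orbit`). -/

theorem IsSelfAdjoint.linearPMap_symmetric (hH : IsSelfAdjoint (⟨D, H⟩ : E →ₗ.[ℂ] E)) (x y : D) :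
    inner ℂ (H x) (y : E) = inner ℂ (x : E) (H y) := by
  have h := LinearPMap.adjoint_isFormalAdjoint hH.dense_domain
  rw [LinearPMap.isSelfAdjoint_def.mp hH] at h
  exact h x y

/-- The hypothesis puts `(y, w)` in the graph of the adjoint, which is the graph of `H`. -/
theorem IsSelfAdjoint.linearPMap_maximal (hH : IsSelfAdjoint (⟨D, H⟩ : E →ₗ.[ℂ] E)) {y w : E}
    (h : ∀ x : D, inner ℂ w (x : E) = inner ℂ y (H x)) : ∃ hy : y ∈ D, H ⟨y, hy⟩ = w := by
  have hmem := LinearPMap.mem_adjoint_domain_of_exists (T := ⟨D, H⟩) y ⟨w, h⟩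
  have happ := LinearPMap.adjoint_apply_eq hH.dense_domain ⟨y, hmem⟩ h
  have hgr : (y, w) ∈ (LinearPMap.adjoint (⟨D, H⟩ : E →ₗ.[ℂ] E)).graph := by
    rw [LinearPMap.mem_graph_iff]
    exact ⟨⟨y, hmem⟩, rfl, happ⟩
  rw [LinearPMap.isSelfAdjoint_def.mp hH, LinearPMap.mem_graph_iff] at hgr
  obtain ⟨z, rfl, hz⟩ := hgr
  exact ⟨z.2, hz⟩

theorem IsSelfAdjoint.norm_sq_add_smul (hH : IsSelfAdjoint (⟨D, H⟩ : E →ₗ.[ℂ] E)) (b : ℝ) (x : D) :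
    ‖H x + (Complex.I * b) • (x : E)‖ ^ 2 = ‖H x‖ ^ 2 + b ^ 2 * ‖(x : E)‖ ^ 2 := by
  have him : (inner ℂ (H x) (x : E)).im = 0 := by
    have h := hH.linearPMap_symmetric x x
    rw [← inner_conj_symm] at h
    have h2 := congrArg Complex.im h
    have h3 := congrArg Complex.im (inner_conj_symm (𝕜 := ℂ) (H x) (x : E))
    simp only [Complex.conj_im] at h2 h3
    rw [← inner_conj_symm, Complex.conj_im]
    linarith
  rw [norm_add_sq (𝕜 := ℂ), inner_smul_right, norm_smul]
  simp only [Complex.norm_mul, Complex.norm_I, Complex.norm_real, one_mul, mul_pow,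
    Real.norm_eq_abs, sq_abs]
  have : RCLike.re (Complex.I * (b : ℂ) * inner ℂ (H x) (x : E)) = 0 := by
    simp [him]
  rw [this]
  ring

theorem IsSelfAdjoint.abs_mul_norm_le (hH : IsSelfAdjoint (⟨D, H⟩ : E →ₗ.[ℂ] E)) (b : ℝ) (x : D) :
    |b| * ‖(x : E)‖ ≤ ‖H x + (Complex.I * b) • (x : E)‖ := by
  apply le_of_sq_le_sq _ (norm_nonneg _)
  rw [hH.norm_sq_add_smul, mul_pow, sq_abs]
  nlinarith [sq_nonneg ‖H x‖]

/-- `H + ib` is bounded below on the graph of `H`, which is complete, so its range is closed. A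
vector orthogonal to the range would be an eigenvector of `H` for `ib`, hence is zero. -/
theorem IsSelfAdjoint.exists_add_smul_eq (hH : IsSelfAdjoint (⟨D, H⟩ : E →ₗ.[ℂ] E)) {b : ℝ}
    (hb : b ≠ 0) (y : E) : ∃ x : D, H x + (Complex.I * b) • (x : E) = y := by
  let L : D →ₗ[ℂ] E := H + (Complex.I * b : ℂ) • D.subtype
  have hL : ∀ x, L x = H x + (Complex.I * b) • (x : E) := fun x => rfl
  have hclosed : IsClosed (LinearMap.range L : Set E) := by
    let G := (⟨D, H⟩ : E →ₗ.[ℂ] E).graph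
    have hG : IsClosed (G : Set (E × E)) := hH.isClosed
    have : CompleteSpace G := hG.completeSpace_coe
    let M : G →L[ℂ] E := (ContinuousLinearMap.snd ℂ E E +
      (Complex.I * b : ℂ) • ContinuousLinearMap.fst ℂ E E).comp G.subtypeL
    have hM : ∀ z : G, M z = (z : E × E).2 + (Complex.I * b) • (z : E × E).1 := fun z => rfl
    have hanti : AntilipschitzWith ⟨1 + |b|⁻¹, by positivity⟩ M := by
      refine M.antilipschitz_of_bound fun z => ?_
      obtain ⟨⟨u, v⟩, hz⟩ := z
      obtain ⟨x, hx, hv⟩ := (LinearPMap.mem_graph_iff _).mp hz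
      have hx : (x : E) = u := hx
      have hv : H x = v := hv
      subst hx hv
      rw [hM]
      have hb' := abs_pos.mpr hb
      have h1 := hH.abs_mul_norm_le b x
      have h2 := hH.norm_sq_add_smul b x
      have h3 : ‖H x‖ ≤ ‖H x + (Complex.I * b) • (x : E)‖ := by
        apply le_of_sq_le_sq _ (norm_nonneg _)
        nlinarith [mul_nonneg (sq_nonneg b) (sq_nonneg ‖(x : E)‖)]
      have h4 : ‖(x : E)‖ ≤ |b|⁻¹ * ‖H x + (Complex.I * b) • (x : E)‖ := by
        rw [inv_mul_eq_div, le_div_iff₀ hb']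
        linarith
      have h5 : 0 ≤ |b|⁻¹ * ‖H x + (Complex.I * b) • (x : E)‖ := by positivity
      change max ‖(x : E)‖ ‖H x‖ ≤ (1 + |b|⁻¹) * ‖H x + (Complex.I * b) • (x : E)‖
      rw [add_mul, one_mul]
      exact max_le (by linarith [norm_nonneg (H x + (Complex.I * b) • (x : E))]) (by linarith)
    have hr := hanti.isClosed_range M.uniformContinuous
    convert hr using 1
    ext w
    constructor
    · rintro ⟨x, rfl⟩
      exact ⟨⟨(x, H x), (LinearPMap.mem_graph_iff _).mpr ⟨x, rfl, rfl⟩⟩, rfl⟩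
    · rintro ⟨⟨⟨u, v⟩, hz⟩, rfl⟩
      obtain ⟨x, hx, hv⟩ := (LinearPMap.mem_graph_iff _).mp hz
      have hx : (x : E) = u := hx
      have hv : H x = v := hv
      subst hx hv
      exact ⟨x, rfl⟩
  have : CompleteSpace (LinearMap.range L) := hclosed.completeSpace_coe
  have htop : LinearMap.range L = ⊤ := by
    rw [← Submodule.orthogonal_eq_bot_iff, Submodule.eq_bot_iff]
    intro z hz
    rw [Submodule.mem_orthogonal'] at hz
    obtain ⟨hzD, hHz⟩ := hH.linearPMap_maximal (y := z) (w := (Complex.I * b) • z) fun x => by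
      have h := hz (L x) ⟨x, rfl⟩
      rw [hL, inner_add_right, inner_smul_right] at h
      rw [inner_smul_left]
      simp only [map_mul, Complex.conj_I, Complex.conj_ofReal]
      linear_combination -h
    have h := hH.abs_mul_norm_le (-b) ⟨z, hzD⟩
    rw [hHz] at h
    have h0 : (Complex.I * b) • z + (Complex.I * ((-b : ℝ) : ℂ)) • z = 0 := by
      rw [← add_smul]
      simp
    rw [h0, norm_zero, abs_neg] at h
    have hb' := abs_pos.mpr hb
    have : ‖z‖ ≤ 0 := by
      by_contra hcon
      push Not at hcon
      exact absurd h (not_le.mpr (mul_pos hb' hcon))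
    exact norm_le_zero_iff.mp this
  have hy : y ∈ LinearMap.range L := htop ▸ Submodule.mem_top
  exact hy

/-- The resolvent `(H + i b)⁻¹` of a self-adjoint operator. -/
theorem IsSelfAdjoint.exists_resolvent (hH : IsSelfAdjoint (⟨D, H⟩ : E →ₗ.[ℂ] E)) {b : ℝ}
    (hb : b ≠ 0) : ∃ R : E →L[ℂ] E,
      (∀ y, ∃ h : R y ∈ D, H ⟨R y, h⟩ + (Complex.I * b) • R y = y) ∧
      (∀ x : D, R (H x + (Complex.I * b) • (x : E)) = x) ∧ ∀ y, |b| * ‖R y‖ ≤ ‖y‖ := by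
  choose r hr using hH.exists_add_smul_eq hb
  have huniq : ∀ x x' : D, H x + (Complex.I * b) • (x : E) = H x' + (Complex.I * b) • (x' : E) →
      x = x' := by
    intro x x' h
    have h1 := hH.abs_mul_norm_le b (x - x')
    have h0 : H (x - x') + (Complex.I * b) • ((x - x' : D) : E) = 0 := by
      rw [map_sub, Submodule.coe_sub, smul_sub]
      rw [sub_add_sub_comm, h, sub_self]
    rw [h0, norm_zero] at h1
    have hb' := abs_pos.mpr hb
    have h2 : ‖((x - x' : D) : E)‖ ≤ 0 := by
      by_contra hcon
      push Not at hcon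
      exact absurd h1 (not_le.mpr (mul_pos hb' hcon))
    have h3 := norm_le_zero_iff.mp h2
    exact sub_eq_zero.mp (Subtype.ext h3)
  have hbound : ∀ y, |b| * ‖(r y : E)‖ ≤ ‖y‖ := fun y => by
    simpa only [hr] using hH.abs_mul_norm_le b (r y)
  let R₀ : E →ₗ[ℂ] E :=
    { toFun := fun y => r y
      map_add' := fun y z => by
        rw [← Submodule.coe_add]
        congr 1
        apply huniq
        rw [hr, map_add, Submodule.coe_add, smul_add]
        nth_rewrite 1 [← hr y]
        nth_rewrite 1 [← hr z]
        abel
      map_smul' := fun c y => by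
        rw [RingHom.id_apply, ← Submodule.coe_smul]
        congr 1
        apply huniq
        rw [hr, map_smul, Submodule.coe_smul, smul_comm, ← smul_add, hr] }
  refine ⟨R₀.mkContinuous |b|⁻¹ fun y => ?_, fun y => ⟨(r y).2, hr y⟩, fun x => ?_, hbound⟩
  · rw [inv_mul_eq_div, le_div_iff₀ (abs_pos.mpr hb), mul_comm]
    exact hbound y
  · exact congrArg Subtype.val (huniq _ _ (hr _))

end SelfAdjoint

/-! ### Bounded regularization and approximate orbits of a frozen Hamiltonian. -/

section Regularization

variable {E : Type*} [NormedAddCommGroup E] [InnerProductSpace ℂ E] [CompleteSpace E]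
  {D : Submodule ℂ E} {H : D →ₗ[ℂ] E}

theorem ContinuousLinearMap.norm_exp_neg_I_smul_and_commute {S : E →L[ℂ] E} (hS : IsSelfAdjoint S) (t : ℝ) :
    let V := NormedSpace.exp (t • (-(Complex.I • S)))
    (∀ y, ‖V y‖ = ‖y‖) ∧ ∀ R : E →L[ℂ] E, Commute R S → Commute R V := by
  intro V
  let : NormedAlgebra ℚ (E →L[ℂ] E) := .restrictScalars ℚ ℂ _
  refine ⟨fun y => ?_, fun R hR => ?_⟩
  · apply ContinuousLinearMap.norm_map_of_mem_unitary
    apply NormedSpace.exp_mem_unitary_of_mem_skewAdjoint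
    rw [skewAdjoint.mem_iff, star_smul, star_neg, star_smul, hS.star_eq]
    simp
  · exact (((hR.smul_right _).neg_right).smul_right t).exp_right

/-- A bounded self-adjoint regularization of `H` which commutes with a resolvent of `H` and is close
to `H` at a given vector. -/
theorem IsSelfAdjoint.exists_bounded_approx (hH : IsSelfAdjoint (⟨D, H⟩ : E →ₗ.[ℂ] E)) (ψ : D)
    {η : ℝ} (hη : 0 < η) : ∃ (b : ℝ) (R S : E →L[ℂ] E), b ≠ 0 ∧
      (∀ y, ∃ h : R y ∈ D, H ⟨R y, h⟩ + (Complex.I * b) • R y = y) ∧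
      (∀ x : D, R (H x + (Complex.I * b) • (x : E)) = x) ∧
      IsSelfAdjoint S ∧ Commute R S ∧ ‖S ψ - H ψ‖ ≤ η := by
  obtain ⟨x, hxD, hx⟩ : ∃ x ∈ D, ‖H ψ - x‖ < η / 3 := by
    obtain ⟨x, hx, h⟩ := Metric.dense_iff.mp hH.dense_domain (H ψ) (η / 3) (by positivity)
    exact ⟨x, h, by rwa [Metric.mem_ball, dist_comm, dist_eq_norm] at hx⟩
  -- Large enough that `‖H x‖ / b ≤ η / 3`; the added 1 keeps `b` positive.
  set b : ℝ := 3 * ‖H ⟨x, hxD⟩‖ / η + 1 with hbdef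
  have hb : 0 < b := by positivity
  obtain ⟨R, hR1, hR2, hR3⟩ := hH.exists_resolvent hb.ne'
  obtain ⟨Q, hQ1, hQ2, hQ3⟩ := hH.exists_resolvent (neg_ne_zero.mpr hb.ne')
  rw [abs_of_pos hb] at hR3
  rw [abs_neg, abs_of_pos hb] at hQ3
  have hQ1' : ∀ y, ∃ h : Q y ∈ D, H ⟨Q y, h⟩ - (Complex.I * b) • Q y = y := fun y => by
    obtain ⟨h, h'⟩ := hQ1 y
    refine ⟨h, Eq.trans ?_ h'⟩
    simp [sub_eq_add_neg]
  have hQ2' : ∀ x : D, Q (H x - (Complex.I * b) • (x : E)) = x := fun x => by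
    refine Eq.trans ?_ (hQ2 x)
    congr 1
    simp [sub_eq_add_neg]
  have hRQ : ∀ y, R y + (2 * (Complex.I * b)) • R (Q y) = Q y := fun y => by
    obtain ⟨h, h'⟩ := hQ1' y
    have h2 := hR2 ⟨Q y, h⟩
    rw [sub_eq_iff_eq_add.mp h', add_assoc, ← add_smul, ← two_mul, map_add, map_smul] at h2
    exact h2
  have hQR : ∀ y, Q y - (2 * (Complex.I * b)) • Q (R y) = R y := fun y => by
    obtain ⟨h, h'⟩ := hR1 y
    have h2 := hQ2' ⟨R y, h⟩
    rw [eq_sub_of_add_eq h', sub_sub, ← add_smul, ← two_mul, map_sub, map_smul] at h2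
    exact h2
  have hcomm : Commute R Q := by
    ext y
    have h1 := hRQ y
    have h2 := hQR y
    have hne : (2 * (Complex.I * b)) ≠ 0 := by simp [hb.ne']
    apply smul_right_injective E hne
    change (2 * (Complex.I * b)) • R (Q y) = (2 * (Complex.I * b)) • Q (R y)
    exact (eq_sub_of_add_eq' h1).trans (sub_eq_iff_eq_add'.mpr (sub_eq_iff_eq_add.mp h2))
  have hadj : star R = Q := by
    rw [ContinuousLinearMap.star_eq_adjoint, eq_comm, ContinuousLinearMap.eq_adjoint_iff]
    intro u v
    obtain ⟨h, h'⟩ := hR1 v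
    obtain ⟨k, k'⟩ := hQ1' u
    have hs := hH.linearPMap_symmetric ⟨Q u, k⟩ ⟨R v, h⟩
    nth_rewrite 2 [← k']
    nth_rewrite 1 [← h']
    rw [inner_add_right, inner_sub_left, inner_smul_left, inner_smul_right, hs]
    simp only [map_mul, Complex.conj_I, Complex.conj_ofReal]
    ring
  -- With this constant `S` is formally `b² H (H² + b²)⁻¹`.
  let c : ℂ := ((b ^ 2 / 2 : ℝ) : ℂ)
  let S : E →L[ℂ] E := c • (R + Q)
  refine ⟨b, R, S, hb.ne', hR1, hR2, ?_, ?_, ?_⟩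
  · have : IsSelfAdjoint (R + Q) := hadj ▸ IsSelfAdjoint.add_star_self R
    exact IsSelfAdjoint.smul (Complex.conj_ofReal _) this
  · exact ((Commute.refl R).add_right hcomm).smul_right c
  -- The factor `(ib/2)(R - Q)` is `b² (H² + b²)⁻¹`: a contraction, within `‖H u‖ / b` of the
  -- identity at `u ∈ D`. As `H ψ` need not lie in `D`, it is compared with the nearby `x`.
  · have hSψ : S ψ = (Complex.I * b / 2) • (R (H ψ) - Q (H ψ)) := by
      have h1 := hR2 ψ
      have h2 := hQ2' ψ
      rw [map_add, map_smul] at h1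
      rw [map_sub, map_smul] at h2
      change c • (R ψ + Q ψ) = _
      have h3 : R (H ψ) - Q (H ψ) = -((Complex.I * b) • (R ψ + Q ψ)) := by
        rw [eq_sub_of_add_eq h1, sub_eq_iff_eq_add.mp h2, smul_add]
        abel
      rw [h3, ← neg_smul, smul_smul]
      congr 1
      simp only [c]
      push_cast
      linear_combination (b : ℂ) ^ 2 / 2 * Complex.I_mul_I
    have hdiff : ∀ u : D, ‖(Complex.I * b / 2) • (R u - Q u) - (u : E)‖ ≤ b⁻¹ * ‖H u‖ := by
      intro u
      have h1 := hR2 u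
      have h2 := hQ2' u
      rw [map_add, map_smul] at h1
      rw [map_sub, map_smul] at h2
      have h3 : (Complex.I * b / 2) • (R u - Q u) - (u : E) =
          (-1 / 2 : ℂ) • (R (H u) + Q (H u)) := by
        have e1 := eq_sub_of_add_eq h1
        have e2 := sub_eq_iff_eq_add.mp h2
        rw [e1, e2]
        module
      have h4 : ‖R (H u)‖ ≤ b⁻¹ * ‖H u‖ := by
        rw [inv_mul_eq_div, le_div_iff₀ hb, mul_comm]
        exact hR3 _
      have h5 : ‖Q (H u)‖ ≤ b⁻¹ * ‖H u‖ := by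
        rw [inv_mul_eq_div, le_div_iff₀ hb, mul_comm]
        exact hQ3 _
      rw [h3, norm_smul]
      have h6 : ‖(-1 / 2 : ℂ)‖ = 1 / 2 := by simp
      rw [h6]
      linarith [norm_add_le (R (H u)) (Q (H u))]
    have hcontr : ∀ u : E, ‖(Complex.I * b / 2) • (R u - Q u)‖ ≤ ‖u‖ := by
      intro u
      have h6 : ‖(Complex.I * b / 2)‖ = b / 2 := by simp [abs_of_pos hb]
      rw [norm_smul, h6]
      have := norm_sub_le (R u) (Q u)
      nlinarith [hR3 u, hQ3 u]
    have hb2 : b⁻¹ * ‖H ⟨x, hxD⟩‖ ≤ η / 3 := by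
      rw [inv_mul_eq_div, div_le_iff₀ hb, hbdef]
      have : η / 3 * (3 * ‖H ⟨x, hxD⟩‖ / η + 1) = ‖H ⟨x, hxD⟩‖ + η / 3 := by
        field_simp
      linarith
    have hsplit : S ψ - H ψ = (Complex.I * b / 2) • (R (H ψ - x) - Q (H ψ - x)) +
        ((Complex.I * b / 2) • (R x - Q x) - x) - (H ψ - x) := by
      rw [hSψ, map_sub, map_sub]
      module
    rw [hsplit]
    have h1 := hcontr (H ψ - x)
    have h2 := hdiff ⟨x, hxD⟩
    refine (norm_sub_le _ _).trans ?_
    have h3 := norm_add_le ((Complex.I * b / 2) • (R (H ψ - x) - Q (H ψ - x)))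
      ((Complex.I * b / 2) • (R x - Q x) - x)
    change _ ≤ b⁻¹ * ‖H ⟨x, hxD⟩‖ at h2
    change ‖(Complex.I * b / 2) • (R x - Q x) - x‖ ≤ _ at h2
    linarith

/-- A norm-preserving curve in the domain of `H`, along which the energy is conserved, and which
solves the Schrödinger equation up to a small error. -/
theorem IsSelfAdjoint.exists_approx_orbit (hH : IsSelfAdjoint (⟨D, H⟩ : E →ₗ.[ℂ] E)) (ψ : D)
    {η : ℝ} (hη : 0 < η) : ∃ χ : ℝ → D, ∃ χ' : ℝ → E, χ 0 = ψ ∧ ∀ t,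
      HasDerivAt (fun τ => (χ τ : E)) (χ' t) t ∧ ‖(χ t : E)‖ = ‖(ψ : E)‖ ∧ ‖H (χ t)‖ = ‖H ψ‖ ∧
      ‖χ' t + Complex.I • H (χ t)‖ ≤ η := by
  obtain ⟨b, R, S, hb, hR1, hR2, hS, hRS, hη'⟩ := hH.exists_bounded_approx ψ hη
  let V : ℝ → E →L[ℂ] E := fun t => NormedSpace.exp (t • (-(Complex.I • S)))
  have hV := fun t => ContinuousLinearMap.norm_exp_neg_I_smul_and_commute hS t
  have hVR : ∀ t y, R (V t y) = V t (R y) := fun t y =>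
    congrArg (fun L : E →L[ℂ] E => L y) ((hV t).2 R hRS).eq
  -- Commuting with the resolvent makes `V t` preserve `D`, the range of `R`, and commute with `H`.
  have hVψ : ∀ t, ∃ h : V t ψ ∈ D, H ⟨V t ψ, h⟩ = V t (H ψ) := by
    intro t
    have h1 : R (V t (H ψ + (Complex.I * b) • (ψ : E))) = V t ψ := by rw [hVR, hR2]
    obtain ⟨h, h'⟩ := hR1 (V t (H ψ + (Complex.I * b) • (ψ : E)))
    simp only [h1] at h h'
    exact ⟨h, add_right_cancel (h'.trans (by rw [map_add, map_smul]))⟩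
  choose hmem hcom using hVψ
  refine ⟨fun t => ⟨V t ψ, hmem t⟩, fun t => V t (-(Complex.I • S ψ)), ?_, fun t => ⟨?_, ?_, ?_, ?_⟩⟩
  · apply Subtype.ext
    simp [V]
  · have h := hasDerivAt_exp_smul_const (𝕂 := ℝ) (-(Complex.I • S)) t
    exact (((ContinuousLinearMap.apply ℂ E (ψ : E)).restrictScalars ℝ).hasFDerivAt.comp_hasDerivAt
      t h)
  · exact (hV t).1 _
  · rw [hcom]
    exact (hV t).1 _
  -- The residual is the isometry `V t` applied to a fixed vector, so its size does not depend on
  -- `t`.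
  · have h : V t (-(Complex.I • S ψ)) + Complex.I • V t (H ψ) =
        V t (Complex.I • (H ψ - S ψ)) := by
      rw [← map_smul (V t), ← map_add, smul_sub, neg_add_eq_sub]
    rw [hcom]
    change ‖V t (-(Complex.I • S ψ)) + Complex.I • V t (H ψ)‖ ≤ η
    rw [h, (hV t).1, norm_smul, Complex.norm_I, one_mul, norm_sub_rev]
    exact hη'

end Regularization

/-! ### Comparison of exact and approximate solutions. -/

section Comparison

variable {E : Type*} [NormedAddCommGroup E] [InnerProductSpace ℂ E] {n : ℕ} {I : Set ℝ}
  {D : Submodule ℂ E} {A : Fin n → D →ₗ[ℂ] E}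

/-- The norm may fail to be differentiable at zeros of `w`; `√(‖w‖² + e)` is differentiable with
derivative at most `ρ` in size, and then `e → 0`. -/
theorem norm_le_add_of_abs_re_inner_deriv_le {w w' : ℝ → E} {a b ρ : ℝ} (hρ : 0 ≤ ρ)
    (hw : ∀ t ∈ Set.uIcc a b, HasDerivWithinAt w (w' t) (Set.uIcc a b) t)
    (hin : ∀ t ∈ Set.uIcc a b, |(inner ℂ (w t) (w' t)).re| ≤ ρ * ‖w t‖) :
    ‖w b‖ ≤ ‖w a‖ + ρ * |b - a| := by
  let _ : InnerProductSpace ℝ E := InnerProductSpace.rclikeToReal ℂ E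
  have key : ∀ e : ℝ, 0 < e → ‖w b‖ ≤ Real.sqrt (‖w a‖ ^ 2 + e) + ρ * |b - a| := by
    intro e he
    have hpos : ∀ t, 0 < ‖w t‖ ^ 2 + e := fun t => by positivity
    have hder : ∀ t ∈ Set.uIcc a b, HasDerivWithinAt (fun τ => Real.sqrt (‖w τ‖ ^ 2 + e))
        (2 * inner ℝ (w t) (w' t) / (2 * Real.sqrt (‖w t‖ ^ 2 + e))) (Set.uIcc a b) t :=
      fun t ht => ((hw t ht).norm_sq.add_const e).sqrt (hpos t).ne'
    have hb : ∀ t ∈ Set.uIcc a b,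
        ‖2 * inner ℝ (w t) (w' t) / (2 * Real.sqrt (‖w t‖ ^ 2 + e))‖ ≤ ρ := by
      intro t ht
      have hs := Real.sqrt_pos.mpr (hpos t)
      rw [mul_div_mul_left _ _ two_ne_zero, norm_div, Real.norm_of_nonneg hs.le, div_le_iff₀ hs]
      refine (hin t ht).trans (mul_le_mul_of_nonneg_left ?_ hρ)
      exact Real.le_sqrt_of_sq_le (by linarith)
    have h := (convex_uIcc a b).norm_image_sub_le_of_norm_hasDerivWithin_le hder hb
      Set.left_mem_uIcc Set.right_mem_uIcc
    have h1 := (le_abs_self _).trans h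
    have h2 : ‖w b‖ ≤ Real.sqrt (‖w b‖ ^ 2 + e) := Real.le_sqrt_of_sq_le (by linarith)
    rw [Real.norm_eq_abs] at h1
    linarith
  have hlim : Filter.Tendsto (fun e : ℝ => Real.sqrt (‖w a‖ ^ 2 + e) + ρ * |b - a|)
      (nhdsWithin 0 (Set.Ioi 0)) (nhds (Real.sqrt (‖w a‖ ^ 2 + 0) + ρ * |b - a|)) := by
    refine Filter.Tendsto.mono_left ?_ nhdsWithin_le_nhds
    exact Continuous.tendsto (by fun_prop) _
  rw [add_zero, Real.sqrt_sq (norm_nonneg _)] at hlim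
  exact ge_of_tendsto hlim (Filter.eventually_of_mem self_mem_nhdsWithin key)

theorem hamiltonianMap_apply (g : Fin n → ℝ → ℝ) (t : ℝ) (x : D) :
    hamiltonianMap A g t x = ∑ i, ((g i t : ℝ) : ℂ) • A i x := by
  simp [hamiltonianMap]

theorem hamiltonianMap_symmetric
    (hA : ∀ i, ∀ x y : D, inner ℂ (A i x) (y : E) = inner ℂ (x : E) (A i y))
    (g : Fin n → ℝ → ℝ) (t : ℝ) (x y : D) :
    inner ℂ (hamiltonianMap A g t x) (y : E) = inner ℂ (x : E) (hamiltonianMap A g t y) := by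
  simp only [hamiltonianMap_apply, sum_inner, inner_sum, inner_smul_left, inner_smul_right, hA,
    Complex.conj_ofReal]

/-- An approximate solution of the Schrödinger equation stays close to the exact one. -/
theorem IsSchrodingerPropagator.norm_sub_le {g : Fin n → ℝ → ℝ} {U : ℝ → ℝ → (E ≃ₗᵢ[ℂ] E)}
    (hU : IsSchrodingerPropagator I D A g U) (hI : I.OrdConnected)
    (hA : ∀ i, ∀ x y : D, inner ℂ (A i x) (y : E) = inner ℂ (x : E) (A i y))
    {a b : ℝ} (ha : a ∈ I) (hb : b ∈ I) {χ : ℝ → D} {χ' : ℝ → E} {ρ : ℝ}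
    (hχ : ∀ t ∈ Set.uIcc a b, HasDerivWithinAt (fun τ => (χ τ : E)) (χ' t) (Set.uIcc a b) t)
    (hρ : ∀ t ∈ Set.uIcc a b, ‖χ' t + Complex.I • hamiltonianMap A g t (χ t)‖ ≤ ρ) :
    ‖U b a (χ a) - χ b‖ ≤ ρ * |b - a| := by
  have hsub : Set.uIcc a b ⊆ I := hI.uIcc_subset ha hb
  have hmem : ∀ t ∈ I, U t a (χ a) ∈ D := fun t ht => (hU.hasDeriv a ha _ (χ a).2 t ht).1
  have hρ0 : 0 ≤ ρ := (norm_nonneg _).trans (hρ a Set.left_mem_uIcc)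
  classical
  -- The value 0 outside `I` only makes `u` total; it is never used.
  let u : ℝ → D := fun t => if h : t ∈ I then ⟨U t a (χ a), hmem t h⟩ else 0
  have hu : ∀ t ∈ I, (u t : E) = U t a (χ a) := fun t ht => by simp [u, ht]
  have hud : ∀ t ∈ Set.uIcc a b, HasDerivWithinAt (fun τ => U τ a (χ a))
      (-(Complex.I • hamiltonianMap A g t (u t))) (Set.uIcc a b) t := fun t ht => by
    obtain ⟨h, h'⟩ := hU.hasDeriv a ha _ (χ a).2 t (hsub ht)
    have : u t = ⟨U t a (χ a), h⟩ := Subtype.ext (hu t (hsub ht))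
    rw [this]
    exact h'.mono hsub
  have h := norm_le_add_of_abs_re_inner_deriv_le hρ0
    (fun t ht => (hud t ht).sub (hχ t ht)) (fun t ht => ?_)
  · simpa [hU.refl a ha] using h
  · have hw : U t a (χ a) - (χ t : E) = ((u t - χ t : D) : E) := by
      rw [Submodule.coe_sub, hu t (hsub ht)]
    have hw' : -(Complex.I • hamiltonianMap A g t (u t)) - χ' t =
        -(Complex.I • hamiltonianMap A g t (u t - χ t)) -
          (χ' t + Complex.I • hamiltonianMap A g t (χ t)) := by
      rw [map_sub, smul_sub]
      abel
    -- Energies are real, so the Hamiltonian part drops out of the real part and only the residual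
    -- remains.
    have him : (inner ℂ ((u t - χ t : D) : E) (hamiltonianMap A g t (u t - χ t))).im = 0 := by
      have h1 := hamiltonianMap_symmetric hA g t (u t - χ t) (u t - χ t)
      rw [← inner_conj_symm] at h1
      have h2 := congrArg Complex.im h1
      rw [Complex.conj_im] at h2
      linarith
    change |(inner ℂ (U t a (χ a) - (χ t : E))
      (-(Complex.I • hamiltonianMap A g t (u t)) - χ' t)).re| ≤ ρ * ‖U t a (χ a) - (χ t : E)‖
    rw [hw, hw', inner_sub_right, inner_neg_right, inner_smul_right]
    simp only [Complex.sub_re, Complex.neg_re, Complex.mul_re, Complex.I_re, Complex.I_im, him,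
      zero_mul, one_mul, sub_zero, neg_zero, zero_sub, abs_neg]
    refine (Complex.abs_re_le_norm _).trans ((norm_inner_le_norm _ _).trans ?_)
    rw [mul_comm]
    exact mul_le_mul_of_nonneg_right (hρ t ht) (norm_nonneg _)

end Comparison

/-! ### Piecewise frozen evolution with graph norm control. -/

section Approximation

variable {E : Type*} [NormedAddCommGroup E] [InnerProductSpace ℂ E] {n : ℕ} {I : Set ℝ}
  {D : Submodule ℂ E} {A : Fin n → D →ₗ[ℂ] E} {f : Fin n → ℝ → ℝ}

theorem norm_hamiltonianMap_sub_le {g : Fin n → ℝ → ℝ} {t x d c : ℝ} {φ : D}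
    (hd : ∀ i, |g i t - f i x| ≤ d) (hd0 : 0 ≤ d) (hc : ∑ i, ‖A i φ‖ ≤ c) :
    ‖hamiltonianMap A g t φ - hamiltonianMap A f x φ‖ ≤ d * c := by
  rw [hamiltonianMap_apply, hamiltonianMap_apply, ← Finset.sum_sub_distrib]
  refine (norm_sum_le _ _).trans (le_trans ?_ (mul_le_mul_of_nonneg_left hc hd0))
  rw [Finset.mul_sum]
  refine Finset.sum_le_sum fun i _ => ?_
  rw [← sub_smul, ← Complex.ofReal_sub, norm_smul, Complex.norm_real]
  exact mul_le_mul_of_nonneg_right (hd i) (norm_nonneg _)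

/-- The graph norm of `H(t)`. -/
def hamiltonianGraphNorm (A : Fin n → D →ₗ[ℂ] E) (f : Fin n → ℝ → ℝ) (t : ℝ) (φ : D) : ℝ :=
  ‖hamiltonianMap A f t φ‖ + ‖(φ : E)‖

theorem hamiltonianGraphNorm_nonneg (t : ℝ) (φ : D) : 0 ≤ hamiltonianGraphNorm A f t φ :=
  add_nonneg (norm_nonneg _) (norm_nonneg _)

theorem AdmissibleCoefficients.exists_sum_norm_le [CompleteSpace E]
    (hf : AdmissibleCoefficients I D A f) :
    ∃ κ : ℝ, 0 ≤ κ ∧ ∀ t ∈ I, ∀ φ : D, ∑ i, ‖A i φ‖ ≤ κ * hamiltonianGraphNorm A f t φ := by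
  choose K hK0 hK using hf.bound
  refine ⟨∑ i, K i, Finset.sum_nonneg fun i _ => (hK0 i).le, fun t ht φ => ?_⟩
  rw [Finset.sum_mul]
  exact Finset.sum_le_sum fun i _ => hK i t ht φ

theorem AdmissibleCoefficients.exists_lipschitz [CompleteSpace E]
    (hf : AdmissibleCoefficients I D A f) {J : Set ℝ} (hJ : IsCompact J) (hJc : Convex ℝ J)
    (hJI : J ⊆ I) :
    ∃ L : ℝ, 0 ≤ L ∧ ∀ i, ∀ x ∈ J, ∀ y ∈ J, |f i y - f i x| ≤ L * |y - x| := by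
  have h : ∀ i, ∃ C, LipschitzOnWith C (f i) J := fun i => by
    refine LocallyLipschitzOn.exists_lipschitzOnWith_of_compact hJ fun x hx => ?_
    exact ((hf.contDiff i).mono hJI x hx).exists_lipschitzOnWith hJc
  choose C hC using h
  refine ⟨∑ i, (C i : ℝ), Finset.sum_nonneg fun i _ => (C i).2, fun i x hx y hy => ?_⟩
  have h1 := (hC i).dist_le_mul y hy x hx
  rw [Real.dist_eq, Real.dist_eq] at h1
  refine h1.trans (mul_le_mul_of_nonneg_right ?_ (abs_nonneg _))
  exact Finset.single_le_sum (f := fun j => (C j : ℝ)) (fun j _ => (C j).2) (Finset.mem_univ i)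

/-- One step of the approximation, with the Hamiltonian frozen at the initial time. -/
theorem AdmissibleCoefficients.exists_approx_step [CompleteSpace E]
    (hf : AdmissibleCoefficients I D A f) (hI : I.OrdConnected)
    (hA : ∀ i, ∀ x y : D, inner ℂ (A i x) (y : E) = inner ℂ (x : E) (A i y))
    {κ : ℝ} (hκ : ∀ t ∈ I, ∀ φ : D, ∑ i, ‖A i φ‖ ≤ κ * hamiltonianGraphNorm A f t φ)
    {x y : ℝ} (hx : x ∈ I) (hy : y ∈ I) (ψ : D) {η : ℝ} (hη : 0 < η) :
    ∃ φ : D, hamiltonianGraphNorm A f x φ = hamiltonianGraphNorm A f x ψ ∧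
      ∀ (g : Fin n → ℝ → ℝ) (U : ℝ → ℝ → (E ≃ₗᵢ[ℂ] E)) (d : ℝ), 0 ≤ d →
        IsSchrodingerPropagator I D A g U → (∀ i, ∀ t ∈ Set.uIcc x y, |g i t - f i x| ≤ d) →
          ‖U y x ψ - φ‖ ≤ (η + d * (κ * hamiltonianGraphNorm A f x ψ)) * |y - x| := by
  obtain ⟨χ, χ', h0, hχ⟩ :=
    IsSelfAdjoint.exists_approx_orbit (H := hamiltonianMap A f x) (hf.selfAdjoint x hx) ψ hη
  have hq : ∀ t, hamiltonianGraphNorm A f x (χ t) = hamiltonianGraphNorm A f x ψ := fun t => by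
    rw [hamiltonianGraphNorm, (hχ t).2.1, (hχ t).2.2.1, hamiltonianGraphNorm]
  refine ⟨χ (y - x), hq _, fun g U d hd hU hg => ?_⟩
  have h := hU.norm_sub_le hI hA hx hy (χ := fun t => χ (t - x)) (χ' := fun t => χ' (t - x))
    (fun t _ => ((hχ (t - x)).1.comp_sub_const t x).hasDerivWithinAt)
    (ρ := η + d * (κ * hamiltonianGraphNorm A f x ψ)) (fun t ht => ?_)
  · simpa [h0] using h
  · have hsplit : χ' (t - x) + Complex.I • hamiltonianMap A g t (χ (t - x)) =
        (χ' (t - x) + Complex.I • hamiltonianMap A f x (χ (t - x))) +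
          Complex.I • (hamiltonianMap A g t (χ (t - x)) - hamiltonianMap A f x (χ (t - x))) := by
      rw [smul_sub]
      abel
    have h1 := norm_hamiltonianMap_sub_le (fun i => hg i t ht) hd (hκ x hx (χ (t - x)))
    rw [hq] at h1
    rw [hsplit]
    refine (norm_add_le _ _).trans (add_le_add (hχ (t - x)).2.2.2 ?_)
    rwa [norm_smul, Complex.norm_I, one_mul]

theorem hamiltonianGraphNorm_le_mul {κ L x y : ℝ} (hL : 0 ≤ L) {φ : D}
    (hκ : ∑ i, ‖A i φ‖ ≤ κ * hamiltonianGraphNorm A f x φ)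
    (hf : ∀ i, |f i y - f i x| ≤ L * |y - x|) :
    hamiltonianGraphNorm A f y φ ≤ (1 + L * κ * |y - x|) * hamiltonianGraphNorm A f x φ := by
  have h := norm_hamiltonianMap_sub_le hf (by positivity) hκ
  have h1 := norm_le_norm_add_norm_sub' (hamiltonianMap A f y φ) (hamiltonianMap A f x φ)
  have h2 : (1 + L * κ * |y - x|) * hamiltonianGraphNorm A f x φ =
      hamiltonianGraphNorm A f x φ + L * |y - x| * (κ * hamiltonianGraphNorm A f x φ) := by ring
  rw [h2]
  unfold hamiltonianGraphNorm at *
  linarith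

/-- A vector which is close to `U(x + k m, x) Ψ` for all propagators `U` belonging to coefficients
close to `f`. -/
theorem AdmissibleCoefficients.exists_approx_iterate [CompleteSpace E]
    (hf : AdmissibleCoefficients I D A f) (hI : I.OrdConnected)
    (hA : ∀ i, ∀ x y : D, inner ℂ (A i x) (y : E) = inner ℂ (x : E) (A i y))
    {κ : ℝ} (hκ0 : 0 ≤ κ)
    (hκ : ∀ t ∈ I, ∀ φ : D, ∑ i, ‖A i φ‖ ≤ κ * hamiltonianGraphNorm A f t φ)
    {J : Set ℝ} (hJI : J ⊆ I) (hJ : J.OrdConnected) {L : ℝ} (hL : 0 ≤ L)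
    (hfL : ∀ i, ∀ x ∈ J, ∀ y ∈ J, |f i y - f i x| ≤ L * |y - x|)
    (Ψ : D) {x m η Q : ℝ} (hη : 0 < η) (N : ℕ)
    (hN : ∀ k ≤ N, x + k * m ∈ J)
    (hQ : ∀ k ≤ N, (1 + L * κ * |m|) ^ k * hamiltonianGraphNorm A f x Ψ ≤ Q) :
    ∀ k ≤ N, ∃ φ : D, hamiltonianGraphNorm A f (x + k * m) φ ≤
        (1 + L * κ * |m|) ^ k * hamiltonianGraphNorm A f x Ψ ∧
      ∀ (g : Fin n → ℝ → ℝ) (U : ℝ → ℝ → (E ≃ₗᵢ[ℂ] E)) (d : ℝ), 0 ≤ d →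
        IsSchrodingerPropagator I D A g U → (∀ i, ∀ t ∈ I, |f i t - g i t| ≤ d) →
          ‖U (x + k * m) x Ψ - φ‖ ≤ k * ((η + (d + L * |m|) * (κ * Q)) * |m|) := by
  have hx : x ∈ I := by simpa using hJI (hN 0 (Nat.zero_le _))
  intro k
  induction k with
  | zero =>
    intro _
    refine ⟨Ψ, by simp, fun g U d _ hU _ => ?_⟩
    simp [hU.refl x hx]
  | succ k ih =>
    intro hk
    have hkN : k ≤ N := Nat.le_of_succ_le hk
    obtain ⟨ψ, hψ, hUψ⟩ := ih hkN
    have hpJ := hN k hkN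
    have hpJ' := hN (k + 1) hk
    have hdiff : x + ((k + 1 : ℕ) : ℝ) * m - (x + k * m) = m := by
      push_cast
      ring
    set p := x + k * m with hp
    set p' := x + ((k + 1 : ℕ) : ℝ) * m with hp'
    obtain ⟨φ, hφ, hUφ⟩ := hf.exists_approx_step hI hA hκ (hJI hpJ) (hJI hpJ') ψ hη
    refine ⟨φ, ?_, fun g U d hd hU hg => ?_⟩
    · have h := hamiltonianGraphNorm_le_mul hL (hκ p (hJI hpJ) φ)
        (fun i => hfL i p hpJ p' hpJ')
      rw [hdiff, hφ] at h
      refine h.trans ?_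
      rw [pow_succ', mul_assoc (1 + L * κ * |m|)]
      exact mul_le_mul_of_nonneg_left hψ (by positivity)
    · have h1 := hUψ g U d hd hU hg
      -- The coefficients of `g` differ from those of `f` frozen at `p` by `d` plus the variation of
      -- `f` over one step.
      have h2 := hUφ g U (d + L * |m|) (by positivity) hU fun i t ht => by
        have htJ : t ∈ J := hJ.uIcc_subset hpJ hpJ' ht
        have h3 : |t - p| ≤ |m| := by
          rw [← hdiff]
          exact Set.abs_sub_left_of_mem_uIcc ht
        have h4 := hfL i p hpJ t htJ
        have h5 := hg i t (hJI htJ)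
        have h6 := mul_le_mul_of_nonneg_left h3 hL
        rw [abs_sub_comm] at h5
        linarith [abs_sub_le (g i t) (f i t) (f i p)]
      rw [hdiff] at h2
      -- The accumulated error is transported isometrically, so step errors simply add.
      have h3 : U p' x Ψ - φ = U p' p (U p x Ψ - ψ) + (U p' p ψ - φ) := by
        rw [map_sub, hU.comp p' (hJI hpJ') p (hJI hpJ) x hx]
        abel
      have hq : hamiltonianGraphNorm A f p ψ ≤ Q := hψ.trans (hQ k hkN)
      have h4 : (η + (d + L * |m|) * (κ * hamiltonianGraphNorm A f p ψ)) * |m| ≤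
          (η + (d + L * |m|) * (κ * Q)) * |m| := by gcongr
      rw [h3]
      refine (norm_add_le _ _).trans ?_
      rw [LinearIsometryEquiv.norm_map]
      push_cast
      linarith

theorem AdmissibleCoefficients.exists_graphNorm_le [CompleteSpace E]
    (hf : AdmissibleCoefficients I D A f) {J : Set ℝ} (hJ : IsCompact J) (hJI : J ⊆ I) (φ : D) :
    ∃ M : ℝ, ∀ t ∈ J, hamiltonianGraphNorm A f t φ ≤ M := by
  have hc : ContinuousOn (fun t => hamiltonianGraphNorm A f t φ) J := by
    simp only [hamiltonianGraphNorm, hamiltonianMap_apply]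
    refine (ContinuousOn.norm ?_).add continuousOn_const
    refine continuousOn_finsetSum _ fun i _ => ?_
    exact (Complex.continuous_ofReal.comp_continuousOn
      ((hf.contDiff i).continuousOn.mono hJI)).smul continuousOn_const
  obtain ⟨M, hM⟩ := hJ.bddAbove_image hc
  exact ⟨M, fun t ht => hM ⟨t, ht, rfl⟩⟩

theorem abs_le_of_supNormOn_lt {h : ℝ → ℝ} {δ : ℝ} (hδ : 0 < δ)
    (hh : supNormOn I h < ENNReal.ofReal δ) {t : ℝ} (ht : t ∈ I) : |h t| ≤ δ := by
  have h1 : ‖h t‖ₑ ≤ ENNReal.ofReal δ :=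
    (le_iSup₂ (f := fun t (_ : t ∈ I) => ‖h t‖ₑ) t ht).trans hh.le
  rw [Real.enorm_eq_ofReal_abs] at h1
  exact (ENNReal.ofReal_le_ofReal_iff hδ.le).mp h1

end Approximation

/-! ### Choice of constants and conclusion. -/

theorem mainTheorem4 {E : Type*} [NormedAddCommGroup E] [InnerProductSpace ℂ E] [CompleteSpace E]
    {n : ℕ} (I : Set ℝ) (hI : I.OrdConnected)
    (D : Submodule ℂ E) (hD : Dense (D : Set E)) (A : Fin n → D →ₗ[ℂ] E)
    (hA : ∀ i, ∀ x y : D, inner ℂ (A i x) (y : E) = inner ℂ (x : E) (A i y))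
    (f : Fin n → ℝ → ℝ) (hf : AdmissibleCoefficients I D A f)
    (U₁ : ℝ → ℝ → (E ≃ₗᵢ[ℂ] E)) (hU₁ : IsSchrodingerPropagator I D A f U₁)
    (Ψ : E) (hΨ : Ψ ∈ D) (T : ℝ) (hT : T ∈ I) (s₀ : ℝ) (hs₀ : s₀ ∈ I) (ε : ℝ) (hε : 0 < ε) :
    ∃ δ : ℝ, 0 < δ ∧ ∀ g : Fin n → ℝ → ℝ, AdmissibleCoefficients I D A g →
      ∀ U₂ : ℝ → ℝ → (E ≃ₗᵢ[ℂ] E), IsSchrodingerPropagator I D A g U₂ →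
        (∀ i, supNormOn I (fun t => f i t - g i t) < ENNReal.ofReal δ) →
          ∀ s ∈ Set.uIcc s₀ T, ‖U₁ T s Ψ - U₂ T s Ψ‖ < ε := by
  have hJI : Set.uIcc s₀ T ⊆ I := hI.uIcc_subset hs₀ hT
  obtain ⟨κ, hκ0, hκ⟩ := hf.exists_sum_norm_le
  obtain ⟨L, hL, hfL⟩ := hf.exists_lipschitz isCompact_uIcc (convex_uIcc s₀ T) hJI
  obtain ⟨M, hM⟩ := hf.exists_graphNorm_le isCompact_uIcc hJI ⟨Ψ, hΨ⟩
  have hM0 : 0 ≤ M := (hamiltonianGraphNorm_nonneg _ _).trans (hM T Set.right_mem_uIcc)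
  set Λ : ℝ := |T - s₀| with hΛ
  have hΛ0 : 0 ≤ Λ := abs_nonneg _
  set Q : ℝ := Real.exp (L * κ * Λ) * M with hQ
  have hQ0 : 0 ≤ Q := by positivity
  obtain ⟨δ, hδ, hδε⟩ : ∃ δ : ℝ, 0 < δ ∧ 2 * ((δ + (δ + δ) * (κ * Q)) * Λ) < ε := by
    -- One `δ` bounds three errors: the coefficient distance, the regularization error `η` and the
    -- variation `L * |m|` per step. The factor 2 accounts for the two propagators.
    refine ⟨ε / (2 * (1 + 2 * (κ * Q)) * Λ + 1), by positivity, ?_⟩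
    have hpos : 0 < 2 * (1 + 2 * (κ * Q)) * Λ + 1 := by positivity
    set r := ε / (2 * (1 + 2 * (κ * Q)) * Λ + 1) with hr
    have hr0 : 0 < r := by positivity
    have hre : r * (2 * (1 + 2 * (κ * Q)) * Λ + 1) = ε := div_mul_cancel₀ _ hpos.ne'
    linarith
  refine ⟨δ, hδ, fun g _ U₂ hU₂ hfg s hs => ?_⟩
  -- Makes the grid fine enough that `L * |m| ≤ δ`.
  obtain ⟨N, hN⟩ := exists_nat_gt (L * Λ / δ)
  have hN0 : 0 < (N : ℝ) := lt_of_le_of_lt (by positivity) hN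
  have hsT : |T - s| ≤ Λ := Set.abs_sub_right_of_mem_uIcc hs
  set m : ℝ := (T - s) / N with hm
  have hNm : N * m = T - s := mul_div_cancel₀ _ hN0.ne'
  have hNm' : N * |m| = |T - s| := by rw [← hNm, abs_mul, Nat.abs_cast]
  have hLm : L * |m| ≤ δ := by
    rw [div_lt_iff₀ hδ] at hN
    have h1 : N * (L * |m|) ≤ N * δ := by
      have := mul_le_mul_of_nonneg_left hsT hL
      nlinarith
    exact le_of_mul_le_mul_left h1 hN0
  have hpts : ∀ k ≤ N, s + k * m ∈ Set.uIcc s₀ T := by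
    intro k hk
    have hk' : (k : ℝ) ≤ N := by exact_mod_cast hk
    have hk1 : (k : ℝ) / N ≤ 1 := (div_le_one hN0).mpr hk'
    have h := (convex_uIcc s₀ T).add_smul_sub_mem hs Set.right_mem_uIcc
      (t := (k : ℝ) / N) ⟨by positivity, hk1⟩
    have e : s + k * m = s + ((k : ℝ) / N) • (T - s) := by
      rw [hm, smul_eq_mul]
      ring
    rwa [e]
  have hpow : ∀ k ≤ N, (1 + L * κ * |m|) ^ k * hamiltonianGraphNorm A f s ⟨Ψ, hΨ⟩ ≤ Q := by
    intro k hk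
    have hk' : (k : ℝ) ≤ N := by exact_mod_cast hk
    refine mul_le_mul ?_ (hM s hs) (hamiltonianGraphNorm_nonneg _ _) (Real.exp_pos _).le
    have h1 : 1 + L * κ * |m| ≤ Real.exp (L * κ * |m|) := by
      linarith [Real.add_one_le_exp (L * κ * |m|)]
    refine (pow_le_pow_left₀ (by positivity) h1 k).trans ?_
    rw [← Real.exp_nat_mul]
    apply Real.exp_le_exp.mpr
    have h2 : k * |m| ≤ Λ := by
      refine le_trans ?_ (hNm'.le.trans hsT)
      exact mul_le_mul_of_nonneg_right hk' (abs_nonneg _)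
    calc k * (L * κ * |m|) = L * κ * (k * |m|) := by ring
      _ ≤ L * κ * Λ := mul_le_mul_of_nonneg_left h2 (by positivity)
  obtain ⟨φ, -, hφ⟩ := hf.exists_approx_iterate hI hA hκ0 hκ hJI Set.ordConnected_uIcc hL hfL
    ⟨Ψ, hΨ⟩ hδ N hpts hpow N le_rfl
  have hend : s + N * m = T := by rw [hNm]; ring
  have hbound : ∀ (g' : Fin n → ℝ → ℝ) (U : ℝ → ℝ → (E ≃ₗᵢ[ℂ] E)),
      IsSchrodingerPropagator I D A g' U → (∀ i, ∀ t ∈ I, |f i t - g' i t| ≤ δ) →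
        ‖U T s Ψ - φ‖ ≤ (δ + (δ + δ) * (κ * Q)) * Λ := by
    intro g' U hU hg'
    have h := hφ g' U δ hδ.le hU hg'
    rw [hend] at h
    refine h.trans ?_
    calc N * ((δ + (δ + L * |m|) * (κ * Q)) * |m|)
        = (δ + (δ + L * |m|) * (κ * Q)) * (N * |m|) := by ring
      _ ≤ (δ + (δ + δ) * (κ * Q)) * Λ := by
        rw [hNm']
        gcongr
  -- The same `φ` serves for `U₁`, with `f` as its own perturbation.
  have h1 := hbound f U₁ hU₁ fun i t _ => by simpa using hδ.le
  have h2 := hbound g U₂ hU₂ fun i t ht => abs_le_of_supNormOn_lt hδ (hfg i) ht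
  have h3 : U₁ T s Ψ - U₂ T s Ψ = (U₁ T s Ψ - φ) - (U₂ T s Ψ - φ) := by abel
  rw [h3]
  linarith [norm_sub_le (U₁ T s Ψ - φ) (U₂ T s Ψ - φ)]
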